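/- **Model.** Let $N$ nodes, $T\ge 1$ time points, $K$ groups and dimensions $R_S,R_D$ be given. A parameter is $\mathcal T=(Z;\{U^{(k)}\}_{k=1}^K;\{V^{(t)}\}_{t=1}^T;\mathcal G)$ with $Z\in\mathbb R^{N\times R_S}$, $U^{(k)}\in\mathbb R^{N\times R_D}$, $V^{(t)}\in\mathbb R^{R_D\times R_D}$ diagonal and group labels $\mathcal G=(g_1,\dots,g_T)\in\{1,\dots,K\}^T$; put $D^{(t)}=U^{(g_t)}V^{(t)}U^{(g_t)\top}$ and $\Theta^{(t)}=ZZ^\top+D^{(t)}$. Let $\tau_1,\tau_2>0$. The parameter space consists of the parameters with $U^{(k)\top}U^{(k)}=N I_{R_D}$ for all $k$ that satisfy (C1) $|\Theta^{(t)}_{ij}|\le\tau_1$ and $|V^{(t)}_{rr}|\le\tau_2$ for all $t,i,j,r$; (C2) $\sum_{t=1}^T D^{(t)}=0$. Let $\mathcal T^*=(Z^*;\{U^{(k)*}\};\{V^{(t)*}\};\mathcal G^*)$ be a true parameter in this space that also satisfies (C3) $|V^{(t)*}_{rr}|\ge\kappa$ for all $t,r$, where $0<\kappa\le\tau_2$.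 The data are random adjacency matrices $A^{(1)},\dots,A^{(T)}\in\{0,1\}^{N\times N}$, symmetric with zero diagonal, whose entries $A^{(t)}_{ij}$, $i<j$, $1\le t\le T$, are independent Bernoulli variables with $\operatorname{logit}P(A^{(t)}_{ij}=1)=\Theta^{(t)*}_{ij}$. Let $$\ell_1(\mathcal T)=-\sum_{t=1}^T\sum_{i=1}^N\sum_{j=1}^N\bigl[A^{(t)}_{ij}\Theta^{(t)}_{ij}-\log\{1+\exp(\Theta^{(t)}_{ij})\}\bigr].$$ An oracle estimator $\widehat{\mathcal T}^{or}=(\widehat Z^{or};\{\widehat U^{(k)or}\};\{\widehat V^{(t)or}\};\widehat{\mathcal G}^{or})$, with labels $\widehat{\mathcal G}^{or}=(\widehat g_1,\dots,\widehat g_T)$, is a minimizer of $\ell_1$ over those parameters of the parameter space for which row $i$ of $U^{(k)}$ is zero whenever row $i$ of $U^{(k)*}$ is zero. For $1\le k\le K$ let $G_k=\{t: g_t^*=k\}$ and $n_k=|G_k|$, and write $d(M,M')=\min_{O^\top O=OO^\top=I_{R_D}}\|M-M'O\|_F^2$. **Claim.** There are absolute constants $c_1,c_2>0$, a constant $C_2>0$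 depending only on $\tau_1$, and, for each $\delta>0$, a constant $C_1>0$ depending only on $\tau_1$ and $\delta$, such that the following holds whenever $T\le\delta N$. Put $\widetilde C_2=C_2(2+\delta)$. With probability at least $1-T\exp(-c_1N)-\exp\{-c_2(2N+T)\}$, every oracle estimator satisfies simultaneously $$\|\widehat Z^{or}\widehat Z^{or\top}-Z^*Z^{*\top}\|_F^2\le \frac{C_1NR_S}{T}+\frac{C_2K^2R_D^2(2N+T)}{T}$$ and, for every $k$ with $n_k\ge1$, $$\frac1{n_k}\sum_{t\in G_k} d\bigl(\widehat U^{(\widehat g_t)or},U^{(k)*}\bigr)\le 8(n_k\kappa^2)^{-1}\bigl(C_1R_S+\widetilde C_2K^2R_D^2\bigr),$$ and there is a label $j\in\{\widehat g_t:t\in G_k\}$ with $$\min_{O^\top O=OO^\top=I_{R_D}}\|\widehat U^{(j)or}-U^{(k)*}O\|_F^2\le 8(n_k\kappa^2)^{-1}\bigl(C_1R_S+\widetilde C_2K^2R_D^2\bigr).$$ In particular, if $\widehat g_t=k$ for all $t\in G_k$, the last bound holds with $j=k$. -/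

import Mathlib

open MeasureTheory ProbabilityTheory

noncomputable section

namespace STANE

/-- The squared Frobenius norm of a real matrix. -/
def frobSq {m n : ℕ} (M : Matrix (Fin m) (Fin n) ℝ) : ℝ :=
  ∑ i, ∑ j, M i j ^ 2

/-- A parameter `(Z; {U^(k)}; {V^(t)}; G)` of the model with `N` nodes, `T` time points, `K` groups
and latent dimensions `RS`, `RD`. The diagonal matrix `V^(t)` is stored through its diagonal `v t`,
and `g t` is the group of time point `t`. -/
structure Param (N T K RS RD : ℕ) where
  Z : Matrix (Fin N) (Fin RS) ℝ
  U : Fin K → Matrix (Fin N) (Fin RD) ℝ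
  v : Fin T → Fin RD → ℝ
  g : Fin T → Fin K

namespace Param

variable {N T K RS RD : ℕ}

/-- The time-invariant part `S = Z Zᵀ`. -/
def S (p : Param N T K RS RD) : Matrix (Fin N) (Fin N) ℝ :=
  p.Z * p.Z.transpose

/-- The time-varying part `D^(t) = U^(g_t) V^(t) U^(g_t)ᵀ`. -/
def D (p : Param N T K RS RD) (t : Fin T) : Matrix (Fin N) (Fin N) ℝ :=
  p.U (p.g t) * Matrix.diagonal (p.v t) * (p.U (p.g t)).transpose

/-- `Θ^(t) = S + D^(t)`. -/
def Theta (p : Param N T K RS RD) (t : Fin T) : Matrix (Fin N) (Fin N) ℝ :=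
  p.S + p.D t

/-- The time points of group `k`. -/
def group (p : Param N T K RS RD) (k : Fin K) : Finset (Fin T) :=
  Finset.univ.filter fun t => p.g t = k

/-- The parameter space: the normalization `U^(k)ᵀ U^(k) = N I`, the boundedness conditions
and the centering condition. -/
structure Admissible (τ₁ τ₂ : ℝ) (p : Param N T K RS RD) : Prop where
  normalized : ∀ k, (p.U k).transpose * p.U k = (N : ℝ) • (1 : Matrix (Fin RD) (Fin RD) ℝ)
  bound_Theta : ∀ t i j, |p.Theta t i j| ≤ τ₁
  bound_V : ∀ t r, |p.v t r| ≤ τ₂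
  centered : ∑ t, p.D t = 0

/-- The diagonal entries of every `V^(t)` are at least `κ` in absolute value. -/
def SignalBound (κ : ℝ) (p : Param N T K RS RD) : Prop :=
  ∀ t r, κ ≤ |p.v t r|

/-- The negative log-likelihood of observed adjacency matrices `A^(1), …, A^(T)`. -/
def negLogLik (A : Fin T → Matrix (Fin N) (Fin N) ℝ) (p : Param N T K RS RD) : ℝ :=
  -∑ t, ∑ i, ∑ j, (A t i j * p.Theta t i j - Real.log (1 + Real.exp (p.Theta t i j)))

/-- The constraint set of the oracle problem with true parameter `q`: the parameter space,
intersected with the requirement that row `i` of `U^(k)` vanishes whenever `i` is outside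
the support `H^(k)` of the true `U^(k)`. -/
def OracleFeasible (τ₁ τ₂ : ℝ) (q p : Param N T K RS RD) : Prop :=
  p.Admissible τ₁ τ₂ ∧ ∀ k i, q.U k i = 0 → p.U k i = 0

/-- `p` is an oracle estimator: a minimizer of the negative log-likelihood over the constraint
set of the oracle problem. -/
def IsOracleEstimator (τ₁ τ₂ : ℝ) (q : Param N T K RS RD)
    (A : Fin T → Matrix (Fin N) (Fin N) ℝ) (p : Param N T K RS RD) : Prop :=
  OracleFeasible τ₁ τ₂ q p ∧ ∀ p', OracleFeasible τ₁ τ₂ q p' → negLogLik A p ≤ negLogLik A p'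

end Param

/-- `A^(1), …, A^(T)` are random adjacency matrices of undirected networks without self-loops,
whose entries above the diagonal are independent over all pairs of nodes and all time points and
satisfy `logit P(A_ij^(t) = 1) = Θ_ij^(t)` for the parameter `q`. -/
structure IsNetworkSample {N T K RS RD : ℕ} {Ω : Type*} [MeasurableSpace Ω] (μ : Measure Ω)
    (q : Param N T K RS RD) (A : Fin T → Ω → Matrix (Fin N) (Fin N) ℝ) : Prop where
  isAdjMatrix : ∀ t ω, (A t ω).IsAdjMatrix
  measurable : ∀ t i j, Measurable fun ω => A t ω i j
  prob_edge : ∀ t i j, i < j → μ.real {ω | A t ω i j = 1} = Real.sigmoid (q.Theta t i j)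
  indep : iIndepFun (fun (e : {e : Fin T × Fin N × Fin N // e.2.1 < e.2.2}) ω =>
    A e.1.1 ω e.1.2.1 e.1.2.2) μ

/-- `min_O ‖M - M' O‖_F²` over the orthogonal matrices `O`. -/
def alignedDist {N R : ℕ} (M M' : Matrix (Fin N) (Fin R) ℝ) : ℝ :=
  ⨅ O : Matrix.orthogonalGroup (Fin R) ℝ, frobSq (M - M' * (O : Matrix (Fin R) (Fin R) ℝ))

end STANE

end

open STANE

namespace STANE

open Matrix

/-! ### Strong convexity of the logistic loss -/

/-! The argument compares likelihoods and never recovers labels. The true parameter is feasible for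
the oracle problem, so strong convexity of the logistic loss on `[-τ₁, τ₁]` gives `γ ∑ₜ ‖ΔΘₜ‖² ≤ ∑ₜ
⟨Eₜ, ΔΘₜ⟩` with `E` the noise (`basic_inequality`). Centering makes the errors of `S` and `D`
orthogonal, so the left side is `γ (T ‖ΔS‖² + ∑ₜ ‖ΔDₜ‖²)` (`sum_frobSq_Theta_sub`).

The right side is governed by the norm `L` of `E` as a trilinear form. `ΔS` is constant in time with
rank at most `2 RS`, which costs `L √T √(2 RS) ‖ΔS‖`. The pairs (estimated label, true label) cut
time into `K²` cells; on each, all `ΔDₜ` share a column space of dimension at most `2 RD`, which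
costs `2 L RD K (∑ₜ ‖ΔDₜ‖²)^(1/2)` in total. Completing squares yields
`Param.IsOracleEstimator.error_le`. A union bound over nets of total size at most `5^(2N+T)` gives
`L = 24 √(2N+T)` outside probability `exp(-(2N+T))` (`IsNetworkSample.trilinBound_noise`).

Finally a Davis–Kahan bound (`alignedDist_le_frobSq`) turns each `‖ΔDₜ‖²` into the aligned distance
from the frame used by the estimator at time `t` to the true frame of that time. Averaging over a
true group gives the second bound, and the best time point of the group gives the third. -/

lemma hasDerivAt_log_one_add_exp (x : ℝ) :
    HasDerivAt (fun y => Real.log (1 + Real.exp y)) (Real.sigmoid x) x := by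
  have h := ((Real.hasDerivAt_exp x).const_add 1).log (by positivity)
  convert h using 1
  rw [Real.sigmoid_def, Real.exp_neg]
  have := Real.exp_pos x
  field_simp
  ring

/-- Subtracting `γ y²` leaves a function with second derivative `σ(z) σ(-z) - σ(-τ)²`, which is
nonnegative for `|z| ≤ τ` because `σ` is increasing. The bound is its tangent line inequality. -/
lemma strongConvexity_log_one_add_exp {τ x y : ℝ} (hx : |x| ≤ τ) (hy : |y| ≤ τ) :
    Real.sigmoid (-τ) ^ 2 / 2 * (y - x) ^ 2 ≤
      Real.log (1 + Real.exp y) - Real.log (1 + Real.exp x) - Real.sigmoid x * (y - x) := by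
  set γ := Real.sigmoid (-τ) ^ 2 / 2 with hγ
  set h : ℝ → ℝ := fun y => Real.log (1 + Real.exp y) - γ * y ^ 2 with hh
  have hd (z : ℝ) : HasDerivAt h (Real.sigmoid z - 2 * γ * z) z := by
    have h1 := (hasDerivAt_log_one_add_exp z).sub (((hasDerivAt_id z).pow 2).const_mul γ)
    refine h1.congr_deriv ?_
    simp
    ring
  have hd2 (z : ℝ) : HasDerivAt (fun z => Real.sigmoid z - 2 * γ * z)
      (Real.sigmoid z * (1 - Real.sigmoid z) - 2 * γ) z := by
    have h1 := (Real.hasDerivAt_sigmoid z).sub ((hasDerivAt_id z).const_mul (2 * γ))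
    refine h1.congr_deriv ?_
    simp
  have hc : ConvexOn ℝ (Set.Icc (-τ) τ) h := by
    refine convexOn_of_hasDerivWithinAt2_nonneg (convex_Icc _ _)
      (fun z _ => (hd z).continuousAt.continuousWithinAt)
      (fun z _ => (hd z).hasDerivWithinAt) (fun z _ => (hd2 z).hasDerivWithinAt) ?_
    intro z hz
    have hz := interior_subset hz
    rw [← Real.sigmoid_neg]
    have h1 : Real.sigmoid (-τ) ≤ Real.sigmoid z := Real.sigmoid_le hz.1
    have h2 : Real.sigmoid (-τ) ≤ Real.sigmoid (-z) := Real.sigmoid_le (by linarith [hz.2])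
    have h3 := mul_le_mul h1 h2 (Real.sigmoid_nonneg _) (Real.sigmoid_nonneg _)
    rw [hγ]
    nlinarith
  have hxs : x ∈ Set.Icc (-τ) τ := abs_le.1 hx
  have hys : y ∈ Set.Icc (-τ) τ := abs_le.1 hy
  have key : h x + (Real.sigmoid x - 2 * γ * x) * (y - x) ≤ h y := by
    rcases lt_trichotomy x y with hxy | hxy | hxy
    · have h1 := hc.le_slope_of_hasDerivAt hxs hys hxy (hd x)
      rw [slope_def_field, le_div_iff₀ (by linarith)] at h1
      linarith
    · simp [hxy]
    · have h1 := hc.slope_le_of_hasDerivAt hys hxs hxy (hd x)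
      rw [slope_def_field, div_le_iff₀ (by linarith)] at h1
      linarith
  simp only [hh] at key
  nlinarith

/-! ### Frobenius norms -/

lemma frobSq_nonneg {m n : ℕ} (M : Matrix (Fin m) (Fin n) ℝ) : 0 ≤ frobSq M :=
  Finset.sum_nonneg fun _ _ => Finset.sum_nonneg fun _ _ => sq_nonneg _

lemma frobSq_eq_trace {m n : ℕ} (M : Matrix (Fin m) (Fin n) ℝ) : frobSq M = (Mᵀ * M).trace := by
  simp only [frobSq, Matrix.trace, Matrix.diag, Matrix.mul_apply, Matrix.transpose_apply, ← sq]
  exact Finset.sum_comm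

lemma frobSq_conj_of_orthonormal {N d : ℕ} {Q : Matrix (Fin N) (Fin d) ℝ} (hQ : Qᵀ * Q = 1)
    (M : Matrix (Fin d) (Fin d) ℝ) : frobSq (Q * M * Qᵀ) = frobSq M := by
  rw [frobSq_eq_trace, frobSq_eq_trace]
  have : (Q * M * Qᵀ)ᵀ * (Q * M * Qᵀ) = Q * (Mᵀ * M) * Qᵀ := by
    simp only [Matrix.transpose_mul, Matrix.transpose_transpose]
    calc Q * (Mᵀ * Qᵀ) * (Q * M * Qᵀ) = Q * Mᵀ * (Qᵀ * Q) * M * Qᵀ := by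
          simp only [Matrix.mul_assoc]
      _ = _ := by simp only [hQ, Matrix.mul_one, Matrix.mul_assoc]
  rw [this, Matrix.trace_mul_cycle, hQ, Matrix.one_mul]

lemma sum_sq_col_of_orthonormal {N d : ℕ} {Q : Matrix (Fin N) (Fin d) ℝ} (hQ : Qᵀ * Q = 1)
    (a : Fin d) : ∑ i, Q i a ^ 2 = 1 := by
  have := congrFun (congrFun hQ a) a
  simpa [Matrix.mul_apply, sq] using this

/-- Factorization of a matrix through an orthonormal basis of its column space. -/
lemma exists_orthonormal_factorization {N : ℕ} {ι : Type*} [Fintype ι] (G : Matrix (Fin N) ι ℝ) :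
    ∃ d ≤ Fintype.card ι, ∃ (Q : Matrix (Fin N) (Fin d) ℝ) (R : Matrix (Fin d) ι ℝ),
      Qᵀ * Q = 1 ∧ G = Q * R := by
  let g : ι → EuclideanSpace ℝ (Fin N) := fun k => WithLp.toLp 2 fun i => G i k
  let W := Submodule.span ℝ (Set.range g)
  let b := stdOrthonormalBasis ℝ W
  refine ⟨Module.finrank ℝ W, finrank_range_le_card g,
    Matrix.of fun i a => (b a : EuclideanSpace ℝ (Fin N)) i,
    Matrix.of fun a k => inner ℝ (b a) (⟨g k, Submodule.subset_span ⟨k, rfl⟩⟩ : W), ?_, ?_⟩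
  · ext a c
    have h := (orthonormal_iff_ite.1 b.orthonormal) a c
    rw [Submodule.coe_inner, PiLp.inner_apply] at h
    rw [Matrix.mul_apply, Matrix.one_apply, ← h]
    refine Finset.sum_congr rfl fun i _ => ?_
    simp [mul_comm]
  · ext i k
    have h := b.sum_repr' (⟨g k, Submodule.subset_span ⟨k, rfl⟩⟩ : W)
    have h2 := congrArg (fun w : W => (w : EuclideanSpace ℝ (Fin N)) i) h
    simp only [Submodule.coe_sum, Submodule.coe_smul] at h2
    rw [Matrix.mul_apply]
    have h3 : G i k = (g k) i := rfl
    rw [h3, ← h2]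
    simp [mul_comm]

/-- A real symmetric matrix is orthogonally diagonalizable. -/
lemma exists_orthogonal_diagonalization {d : ℕ} {M : Matrix (Fin d) (Fin d) ℝ} (hM : Mᵀ = M) :
    ∃ (V : Matrix (Fin d) (Fin d) ℝ) (l : Fin d → ℝ),
      Vᵀ * V = 1 ∧ M = V * Matrix.diagonal l * Vᵀ := by
  have hH : M.IsHermitian := by
    rw [Matrix.IsHermitian, Matrix.conjTranspose_eq_transpose_of_trivial, hM]
  have h := hH.spectral_theorem
  refine ⟨hH.eigenvectorUnitary, hH.eigenvalues, ?_, ?_⟩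
  · have := Unitary.coe_star_mul_self hH.eigenvectorUnitary
    rwa [Matrix.star_eq_conjTranspose, Matrix.conjTranspose_eq_transpose_of_trivial] at this
  · rw [Unitary.conjStarAlgAut_apply] at h
    rwa [Matrix.star_eq_conjTranspose, Matrix.conjTranspose_eq_transpose_of_trivial] at h

/-! ### Alignment of orthonormal frames -/

/-- A contraction has an orthogonal matrix whose inner product with it is at least the squared
Frobenius norm. -/
lemma exists_orthogonal_frobSq_le_trace {R : ℕ} {M : Matrix (Fin R) (Fin R) ℝ}
    (hM : ∀ x : Fin R → ℝ, (M *ᵥ x) ⬝ᵥ (M *ᵥ x) ≤ x ⬝ᵥ x) :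
    ∃ O ∈ Matrix.orthogonalGroup (Fin R) ℝ, frobSq M ≤ (Mᵀ * O).trace := by
  obtain ⟨V, l, hV, hl⟩ := exists_orthogonal_diagonalization (M := Mᵀ * M) (by simp)
  have hV' : V * Vᵀ = 1 := mul_eq_one_comm.1 hV
  set W := M * V with hW
  have hWW : Wᵀ * W = Matrix.diagonal l := by
    calc Wᵀ * W = Vᵀ * (Mᵀ * M) * V := by simp only [hW, Matrix.transpose_mul, Matrix.mul_assoc]
      _ = (Vᵀ * V) * Matrix.diagonal l * (Vᵀ * V) := by rw [hl]; simp only [Matrix.mul_assoc]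
      _ = _ := by simp [hV]
  have hin (i j : Fin R) : ∑ k, W k i * W k j = if i = j then l i else 0 := by
    have := congrFun (congrFun hWW i) j
    simpa [Matrix.mul_apply, Matrix.diagonal_apply] using this
  have hl0 (i : Fin R) : 0 ≤ l i := by
    have := hin i i
    rw [if_pos rfl] at this
    rw [← this]
    exact Finset.sum_nonneg fun k _ => mul_self_nonneg _
  have hl1 (i : Fin R) : l i ≤ 1 := by
    have h1 := hM (fun k => V k i)
    have h2 : M *ᵥ (fun k => V k i) = fun k => W k i := by
      ext k; simp [hW, Matrix.mul_apply, Matrix.mulVec, dotProduct]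
    rw [h2] at h1
    have h3 := hin i i
    rw [if_pos rfl] at h3
    have h4 := sum_sq_col_of_orthonormal hV i
    simp only [dotProduct, ← sq] at h1 h3 ⊢
    linarith
  -- The columns of `W = M V` are orthogonal with squared lengths `l i`. The nonzero ones are
  -- normalized to left singular vectors and completed to an orthonormal basis, so a singular `M`
  -- needs no separate treatment.
  let v : Fin R → EuclideanSpace ℝ (Fin R) := fun i => WithLp.toLp 2 fun k => (√(l i))⁻¹ * W k i
  obtain ⟨b, hb⟩ := Orthonormal.exists_orthonormalBasis_extension_of_card_eq (𝕜 := ℝ)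
    (E := EuclideanSpace ℝ (Fin R)) (ι := Fin R) (by simp) (v := v) (s := {i | l i ≠ 0}) (by
      rw [orthonormal_iff_ite]
      rintro ⟨i, hi⟩ ⟨j, hj⟩
      have hpos : 0 < l i := lt_of_le_of_ne (hl0 i) (Ne.symm hi)
      simp only [Set.domRestrict_apply, v, PiLp.inner_apply, Subtype.mk.injEq]
      have : ∑ k, inner ℝ ((√(l i))⁻¹ * W k i) ((√(l j))⁻¹ * W k j)
          = (√(l i))⁻¹ * (√(l j))⁻¹ * ∑ k, W k i * W k j := by
        rw [Finset.mul_sum]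
        refine Finset.sum_congr rfl fun k _ => ?_
        simp
        ring
      rw [this, hin]
      split_ifs with hij
      · subst hij
        rw [← mul_inv, Real.mul_self_sqrt (hl0 i), inv_mul_cancel₀ hi]
      · simp)
  let B : Matrix (Fin R) (Fin R) ℝ := Matrix.of fun k i => b i k
  have hB : Bᵀ * B = 1 := by
    ext i j
    have h := (orthonormal_iff_ite.1 b.orthonormal) i j
    rw [PiLp.inner_apply] at h
    rw [Matrix.mul_apply, Matrix.one_apply, ← h]
    refine Finset.sum_congr rfl fun k _ => ?_
    simp [B, mul_comm]
  have hWB (i : Fin R) : ∑ k, W k i * B k i = √(l i) := by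
    by_cases hi : l i = 0
    · have h1 := hin i i
      rw [if_pos rfl, hi, Finset.sum_eq_zero_iff_of_nonneg fun k _ => mul_self_nonneg _] at h1
      rw [hi, Real.sqrt_zero]
      refine Finset.sum_eq_zero fun k hk => ?_
      rw [mul_self_eq_zero.1 (h1 k hk), zero_mul]
    · have h1 (k : Fin R) : B k i = (√(l i))⁻¹ * W k i := by
        simp only [B, Matrix.of_apply, hb i hi, v]
      have h2 : ∑ k, W k i * B k i = (√(l i))⁻¹ * ∑ k, W k i * W k i := by
        rw [Finset.mul_sum]
        refine Finset.sum_congr rfl fun k _ => ?_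
        rw [h1]; ring
      rw [h2, hin, if_pos rfl]
      nth_rewrite 2 [← Real.mul_self_sqrt (hl0 i)]
      have : √(l i) ≠ 0 := (Real.sqrt_pos.2 (lt_of_le_of_ne (hl0 i) (Ne.symm hi))).ne'
      field_simp
  refine ⟨B * Vᵀ, ?_, ?_⟩
  · rw [Matrix.mem_orthogonalGroup_iff']
    calc star (B * Vᵀ) * (B * Vᵀ) = V * (Bᵀ * B) * Vᵀ := by
          rw [Matrix.star_eq_conjTranspose, Matrix.conjTranspose_eq_transpose_of_trivial]
          simp only [Matrix.transpose_mul, Matrix.transpose_transpose, Matrix.mul_assoc]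
      _ = 1 := by rw [hB, Matrix.mul_one, hV']
  · have h1 : (Mᵀ * (B * Vᵀ)).trace = ∑ i, √(l i) := by
      rw [← Matrix.mul_assoc, Matrix.trace_mul_comm, ← Matrix.mul_assoc, ← Matrix.transpose_mul, ← hW]
      simp only [Matrix.trace, Matrix.diag, Matrix.mul_apply, Matrix.transpose_apply, hWB]
    have h2 : frobSq M = ∑ i, l i := by
      rw [frobSq_eq_trace, hl, Matrix.mul_assoc, Matrix.trace_mul_comm, Matrix.mul_assoc, hV,
        Matrix.mul_one, Matrix.trace_diagonal]
    rw [h1, h2]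
    refine Finset.sum_le_sum fun i _ => ?_
    -- The trace is the sum of the singular values and `frobSq M` the sum of their squares; these
    -- lie in `[0, 1]`.
    exact Real.le_sqrt_of_sq_le (by nlinarith [hl0 i, hl1 i])

lemma alignedDist_le {N R : ℕ} (M M' : Matrix (Fin N) (Fin R) ℝ) {O : Matrix (Fin R) (Fin R) ℝ}
    (hO : O ∈ Matrix.orthogonalGroup (Fin R) ℝ) : alignedDist M M' ≤ frobSq (M - M' * O) :=
  ciInf_le (f := fun O : Matrix.orthogonalGroup (Fin R) ℝ =>
    frobSq (M - M' * (O : Matrix (Fin R) (Fin R) ℝ)))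
    ⟨0, by rintro _ ⟨O, rfl⟩; exact frobSq_nonneg _⟩ ⟨O, hO⟩

/-- Pythagoras for the complementary orthogonal projections `P` and `1 - P`. -/
lemma frobSq_projection_mul_le {N m : ℕ} {P : Matrix (Fin N) (Fin N) ℝ} (hPt : Pᵀ = P)
    (hP : P * P = P) (X : Matrix (Fin N) (Fin m) ℝ) : frobSq (P * X) ≤ frobSq X := by
  have h1 : frobSq X = frobSq (P * X) + frobSq ((1 - P) * X) := by
    simp only [frobSq_eq_trace]
    rw [← Matrix.trace_add]
    congr 1
    simp only [Matrix.transpose_mul, Matrix.transpose_sub, Matrix.transpose_one, hPt]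
    have e1 : Xᵀ * P * (P * X) = Xᵀ * P * X := by
      rw [Matrix.mul_assoc, ← Matrix.mul_assoc P, hP, ← Matrix.mul_assoc]
    have e2 : Xᵀ * (1 - P) * ((1 - P) * X) = Xᵀ * X - Xᵀ * P * X := by
      have : (1 - P) * (1 - P) = 1 - P := by
        rw [Matrix.mul_sub, Matrix.sub_mul, Matrix.sub_mul, hP]; simp
      rw [Matrix.mul_assoc, ← Matrix.mul_assoc (1 - P), this, Matrix.sub_mul, Matrix.mul_sub,
        Matrix.one_mul, Matrix.mul_assoc]
    rw [e1, e2]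
    abel
  linarith [frobSq_nonneg ((1 - P) * X)]

/-- A Davis–Kahan bound: the distance between two normalized frames after the best alignment is
controlled by the distance of the low-rank matrices they span. -/
lemma alignedDist_le_frobSq {N R : ℕ} (hN : 0 < N) {κ : ℝ} (hκ : 0 < κ)
    {U U' : Matrix (Fin N) (Fin R) ℝ} {v v' : Fin R → ℝ}
    (hU : Uᵀ * U = (N : ℝ) • (1 : Matrix (Fin R) (Fin R) ℝ))
    (hU' : U'ᵀ * U' = (N : ℝ) • (1 : Matrix (Fin R) (Fin R) ℝ)) (hv' : ∀ r, κ ≤ |v' r|) :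
    alignedDist U U' ≤ 2 / (N * κ ^ 2) *
      frobSq (U * Matrix.diagonal v * Uᵀ - U' * Matrix.diagonal v' * U'ᵀ) := by
  have hN' : (0 : ℝ) < N := by exact_mod_cast hN
  set M : Matrix (Fin R) (Fin R) ℝ := (N : ℝ)⁻¹ • (U'ᵀ * U) with hM
  have hnorm {W : Matrix (Fin N) (Fin R) ℝ} (hW : Wᵀ * W = (N : ℝ) • (1 : Matrix (Fin R) (Fin R) ℝ))
      (x : Fin R → ℝ) : (W *ᵥ x) ⬝ᵥ (W *ᵥ x) = N * (x ⬝ᵥ x) := by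
    rw [Matrix.dotProduct_mulVec, Matrix.vecMul_mulVec, hW, Matrix.vecMul_smul,
      Matrix.vecMul_one, smul_dotProduct, smul_eq_mul]
  obtain ⟨O, hO, hOM⟩ := exists_orthogonal_frobSq_le_trace (M := M) (by
    intro x
    set w := U *ᵥ x with hw
    set y := U'ᵀ *ᵥ w with hy
    have h1 : M *ᵥ x = (N : ℝ)⁻¹ • y := by
      rw [hM, Matrix.smul_mulVec, ← Matrix.mulVec_mulVec]
    -- Bessel's inequality: the residual of `w` after projection onto the columns of `U'` has
    -- nonnegative squared norm.
    have h2 : 0 ≤ (w - (N : ℝ)⁻¹ • (U' *ᵥ y)) ⬝ᵥ (w - (N : ℝ)⁻¹ • (U' *ᵥ y)) := by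
      simp only [dotProduct]
      exact Finset.sum_nonneg fun _ _ => mul_self_nonneg _
    have h3 : w ⬝ᵥ (U' *ᵥ y) = y ⬝ᵥ y := by
      rw [Matrix.dotProduct_mulVec, ← Matrix.mulVec_transpose]
    have h4 := hnorm hU' y
    have h5 : w ⬝ᵥ w = N * (x ⬝ᵥ x) := hnorm hU x
    simp only [dotProduct_sub, sub_dotProduct, smul_dotProduct, dotProduct_smul, smul_eq_mul] at h2
    rw [dotProduct_comm (U' *ᵥ y) w, h3, h4, h5] at h2
    rw [h1, smul_dotProduct, dotProduct_smul, smul_eq_mul, smul_eq_mul]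
    have h6 : (N : ℝ)⁻¹ * (N * (y ⬝ᵥ y)) = y ⬝ᵥ y := by field_simp
    rw [h6] at h2
    have h7 : (N : ℝ)⁻¹ * (y ⬝ᵥ y) ≤ N * (x ⬝ᵥ x) := by linarith
    calc (N : ℝ)⁻¹ * ((N : ℝ)⁻¹ * (y ⬝ᵥ y)) ≤ (N : ℝ)⁻¹ * (N * (x ⬝ᵥ x)) := by gcongr
      _ = x ⬝ᵥ x := by field_simp)
  have hO' : Oᵀ * O = 1 := (Matrix.mem_orthogonalGroup_iff' (Fin R) ℝ).1 hO
  have htr1 : ((N : ℝ) • (1 : Matrix (Fin R) (Fin R) ℝ)).trace = N * R := by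
    simp [Matrix.trace_smul]
  -- the aligned distance
  have hdist : frobSq (U - U' * O) = 2 * (N * R) - 2 * (N * (Mᵀ * O).trace) := by
    have e1 : (U - U' * O)ᵀ * (U - U' * O)
        = Uᵀ * U - Uᵀ * U' * O - (Uᵀ * U' * O)ᵀ + Oᵀ * (U'ᵀ * U') * O := by
      simp only [Matrix.transpose_sub, Matrix.transpose_mul, Matrix.sub_mul, Matrix.mul_sub,
        Matrix.transpose_transpose, Matrix.mul_assoc]
      abel
    have e2 : Mᵀ = (N : ℝ)⁻¹ • (Uᵀ * U') := by
      rw [hM, Matrix.transpose_smul, Matrix.transpose_mul, Matrix.transpose_transpose]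
    rw [frobSq_eq_trace, e1, hU, hU', Matrix.trace_add, Matrix.trace_sub, Matrix.trace_sub,
      Matrix.trace_transpose, htr1, e2, Matrix.smul_mul, Matrix.trace_smul, Matrix.mul_smul,
      Matrix.mul_one, Matrix.smul_mul, hO', htr1, smul_eq_mul, mul_inv_cancel_left₀ hN'.ne']
    ring
  -- the projection onto the orthogonal complement of the columns of `U`
  set P : Matrix (Fin N) (Fin N) ℝ := 1 - (N : ℝ)⁻¹ • (U * Uᵀ) with hP
  have hPU : P * U = 0 := by
    rw [hP, Matrix.sub_mul, Matrix.one_mul, Matrix.smul_mul, Matrix.mul_assoc, hU, Matrix.mul_smul,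
      Matrix.mul_one, smul_smul, inv_mul_cancel₀ hN'.ne', one_smul, sub_self]
  have hPt : Pᵀ = P := by
    rw [hP, Matrix.transpose_sub, Matrix.transpose_smul, Matrix.transpose_mul,
      Matrix.transpose_transpose, Matrix.transpose_one]
  have hPP : P * P = P := by
    nth_rewrite 2 [hP]
    rw [Matrix.mul_sub, Matrix.mul_one, Matrix.mul_smul, ← Matrix.mul_assoc, hPU, Matrix.zero_mul,
      smul_zero, sub_zero]
  set X := U * Matrix.diagonal v * Uᵀ - U' * Matrix.diagonal v' * U'ᵀ with hX
  -- `P` annihilates the term containing `v`, so only `v'` has to be bounded away from zero.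
  have hPX : P * X = -(P * U' * Matrix.diagonal v' * U'ᵀ) := by
    rw [hX, Matrix.mul_sub, ← Matrix.mul_assoc, ← Matrix.mul_assoc, hPU, Matrix.zero_mul,
      Matrix.zero_mul, zero_sub]
    simp only [Matrix.mul_assoc]
  set Y := P * U' with hY
  have hYY : Yᵀ * Y = U'ᵀ * U' - (N : ℝ)⁻¹ • (U'ᵀ * U * (Uᵀ * U')) := by
    calc Yᵀ * Y = U'ᵀ * (P * P) * U' := by
          rw [hY, Matrix.transpose_mul, hPt]; simp only [Matrix.mul_assoc]
      _ = _ := by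
          rw [hPP, hP, Matrix.mul_sub, Matrix.sub_mul, Matrix.mul_one, Matrix.mul_smul,
            Matrix.smul_mul]
          simp only [Matrix.mul_assoc]
  have htrY : (Yᵀ * Y).trace = N * R - N * frobSq M := by
    have e : frobSq M = (N : ℝ)⁻¹ * ((N : ℝ)⁻¹ * (U'ᵀ * U * (Uᵀ * U')).trace) := by
      rw [frobSq_eq_trace, hM, Matrix.transpose_smul, Matrix.smul_mul, Matrix.mul_smul,
        Matrix.trace_smul, Matrix.trace_smul, Matrix.transpose_mul, Matrix.transpose_transpose,
        Matrix.trace_mul_comm, smul_eq_mul, smul_eq_mul]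
    rw [hYY, hU', Matrix.trace_sub, htr1, Matrix.trace_smul, smul_eq_mul, e,
      mul_inv_cancel_left₀ hN'.ne']
  have hPXsq : N * κ ^ 2 * (Yᵀ * Y).trace ≤ frobSq (P * X) := by
    have e1 : frobSq (P * X) = N * ∑ r, v' r ^ 2 * (Yᵀ * Y) r r := by
      rw [frobSq_eq_trace, hPX, Matrix.transpose_neg, neg_mul_neg]
      have : (Y * Matrix.diagonal v' * U'ᵀ)ᵀ * (Y * Matrix.diagonal v' * U'ᵀ)
          = U' * (Matrix.diagonal v' * (Yᵀ * Y) * Matrix.diagonal v') * U'ᵀ := by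
        simp only [Matrix.transpose_mul, Matrix.transpose_transpose, Matrix.diagonal_transpose,
          Matrix.mul_assoc]
      rw [this, Matrix.trace_mul_cycle, hU', Matrix.smul_mul, Matrix.one_mul, Matrix.trace_smul,
        smul_eq_mul]
      congr 1
      simp only [Matrix.trace, Matrix.diag, Matrix.mul_diagonal, Matrix.diagonal_mul]
      exact Finset.sum_congr rfl fun r _ => by ring
    rw [e1, mul_assoc, Matrix.trace, Finset.mul_sum]
    refine mul_le_mul_of_nonneg_left (Finset.sum_le_sum fun r _ => ?_) hN'.le
    refine mul_le_mul_of_nonneg_right ?_ ?_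
    · rw [← sq_abs (v' r)]
      exact pow_le_pow_left₀ hκ.le (hv' r) 2
    · change 0 ≤ (Yᵀ * Y) r r
      rw [Matrix.mul_apply]
      exact Finset.sum_nonneg fun _ _ => mul_self_nonneg _
  have hle := frobSq_projection_mul_le hPt hPP X
  -- The aligned distance is at most `2 (N R - N ‖M‖²)`, and `N R - N ‖M‖²` is exactly `‖P U'‖²`.
  have h1 : alignedDist U U' ≤ 2 * (Yᵀ * Y).trace := by
    refine (alignedDist_le U U' hO).trans ?_
    rw [hdist, htrY]
    have := mul_le_mul_of_nonneg_left hOM hN'.le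
    linarith
  have h2 : (Yᵀ * Y).trace ≤ frobSq X / (N * κ ^ 2) := by
    rw [le_div_iff₀ (by positivity)]
    linarith
  calc alignedDist U U' ≤ 2 * (frobSq X / (N * κ ^ 2)) := by linarith
    _ = _ := by ring

/-! ### Trilinear forms -/

/-- The trilinear form of a family of matrices. -/
def trilin {N T : ℕ} (E : Fin T → Matrix (Fin N) (Fin N) ℝ) (x y : Fin N → ℝ) (z : Fin T → ℝ) : ℝ :=
  ∑ t, ∑ i, ∑ j, z t * x i * y j * E t i j

/-- The trilinear form of `E` has norm at most `L`. -/
def TrilinBound {N T : ℕ} (E : Fin T → Matrix (Fin N) (Fin N) ℝ) (L : ℝ) : Prop :=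
  ∀ x y z, trilin E x y z ≤ L * √(∑ i, x i ^ 2) * √(∑ i, y i ^ 2) * √(∑ t, z t ^ 2)

/-- The Frobenius inner product. -/
def frobInner {m n : ℕ} (M M' : Matrix (Fin m) (Fin n) ℝ) : ℝ := ∑ i, ∑ j, M i j * M' i j

lemma frobInner_eq_trace {m n : ℕ} (M M' : Matrix (Fin m) (Fin n) ℝ) :
    frobInner M M' = (Mᵀ * M').trace := by
  simp only [frobInner, Matrix.trace, Matrix.diag, Matrix.mul_apply, Matrix.transpose_apply]
  exact Finset.sum_comm

lemma frobInner_conj {N d : ℕ} (E : Matrix (Fin N) (Fin N) ℝ) (Q : Matrix (Fin N) (Fin d) ℝ)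
    (M : Matrix (Fin d) (Fin d) ℝ) :
    frobInner E (Q * M * Qᵀ) = ∑ a, ∑ b, M a b * ∑ i, ∑ j, Q i a * Q j b * E i j := by
  have h1 : frobInner E (Q * M * Qᵀ) = frobInner M (Qᵀ * E * Q) := by
    rw [frobInner_eq_trace, frobInner_eq_trace, ← Matrix.trace_transpose]
    simp only [Matrix.transpose_mul, Matrix.transpose_transpose, Matrix.mul_assoc]
    rw [Matrix.trace_mul_comm]
    simp only [Matrix.mul_assoc]
  rw [h1, frobInner]
  refine Finset.sum_congr rfl fun a _ => Finset.sum_congr rfl fun b _ => ?_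
  congr 1
  simp only [Matrix.mul_apply, Matrix.transpose_apply, Finset.sum_mul]
  rw [Finset.sum_comm]
  exact Finset.sum_congr rfl fun i _ => Finset.sum_congr rfl fun j _ => by ring

lemma trilin_eq {N T : ℕ} (E : Fin T → Matrix (Fin N) (Fin N) ℝ) (x y : Fin N → ℝ)
    (z : Fin T → ℝ) : trilin E x y z = ∑ t, z t * ∑ i, ∑ j, x i * y j * E t i j := by
  simp only [trilin, Finset.mul_sum]
  exact Finset.sum_congr rfl fun t _ => Finset.sum_congr rfl fun i _ =>
    Finset.sum_congr rfl fun j _ => by ring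

/-- Bound of a linear functional on a sequence of matrices with a common low-dimensional row and
column space. -/
lemma TrilinBound.sum_frobInner_le {N T : ℕ} {E : Fin T → Matrix (Fin N) (Fin N) ℝ} {L : ℝ}
    (hE : TrilinBound E L) (hL : 0 ≤ L) {ι : Type*} [Fintype ι] (G : Matrix (Fin N) ι ℝ)
    (H : Fin T → Matrix ι ι ℝ) :
    ∑ t, frobInner (E t) (G * H t * Gᵀ) ≤
      L * Fintype.card ι * √(∑ t, frobSq (G * H t * Gᵀ)) := by
  obtain ⟨d, hd, Q, R, hQ, rfl⟩ := exists_orthonormal_factorization G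
  set m : Fin T → Matrix (Fin d) (Fin d) ℝ := fun t => R * H t * Rᵀ with hm
  have e1 (t : Fin T) : Q * R * H t * (Q * R)ᵀ = Q * m t * Qᵀ := by
    simp only [hm, Matrix.transpose_mul, Matrix.mul_assoc]
  simp only [e1, frobSq_conj_of_orthonormal hQ]
  have e2 : ∑ t, frobInner (E t) (Q * m t * Qᵀ)
      = ∑ p : Fin d × Fin d,
        trilin E (fun i => Q i p.1) (fun j => Q j p.2) (fun t => m t p.1 p.2) := by
    rw [Finset.sum_congr rfl fun t _ => frobInner_conj _ _ _, Fintype.sum_prod_type,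
      Finset.sum_comm]
    refine Finset.sum_congr rfl fun a _ => ?_
    rw [Finset.sum_comm]
    exact Finset.sum_congr rfl fun b _ => (trilin_eq _ _ _ _).symm
  rw [e2]
  have e3 (p : Fin d × Fin d) :
      trilin E (fun i => Q i p.1) (fun j => Q j p.2) (fun t => m t p.1 p.2)
        ≤ L * √(∑ t, m t p.1 p.2 ^ 2) := by
    have := hE (fun i => Q i p.1) (fun j => Q j p.2) (fun t => m t p.1 p.2)
    simpa [sum_sq_col_of_orthonormal hQ] using this
  refine (Finset.sum_le_sum fun p _ => e3 p).trans ?_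
  rw [← Finset.mul_sum, mul_assoc]
  refine mul_le_mul_of_nonneg_left ?_ hL
  -- Cauchy–Schwarz over the `d²` pairs of basis vectors costs a factor `d`.
  have e4 := Real.sum_mul_le_sqrt_mul_sqrt (Finset.univ : Finset (Fin d × Fin d)) (fun _ => 1)
    (fun p => √(∑ t, m t p.1 p.2 ^ 2))
  have e5 : ∑ p : Fin d × Fin d, √(∑ t, m t p.1 p.2 ^ 2) ^ 2 = ∑ t, frobSq (m t) := by
    rw [Finset.sum_congr rfl fun p _ => Real.sq_sqrt (Finset.sum_nonneg fun t _ => sq_nonneg _)]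
    rw [Finset.sum_comm]
    simp only [frobSq, Fintype.sum_prod_type]
  have e6 : √(∑ _p : Fin d × Fin d, (1 : ℝ) ^ 2) = d := by
    simp
  rw [e5, e6] at e4
  simp only [one_mul] at e4
  refine e4.trans ?_
  gcongr

/-- Bound of a linear functional on a constant sequence of symmetric low-rank matrices. -/
lemma TrilinBound.sum_frobInner_const_le {N T : ℕ} {E : Fin T → Matrix (Fin N) (Fin N) ℝ} {L : ℝ}
    (hE : TrilinBound E L) (hL : 0 ≤ L) {ι : Type*} [Fintype ι] (G : Matrix (Fin N) ι ℝ)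
    {H : Matrix ι ι ℝ} (hH : Hᵀ = H) :
    ∑ t, frobInner (E t) (G * H * Gᵀ) ≤
      L * √T * √(Fintype.card ι) * √(frobSq (G * H * Gᵀ)) := by
  obtain ⟨d, hd, Q, R, hQ, rfl⟩ := exists_orthonormal_factorization G
  -- Since the matrix does not vary with time, it can be diagonalized once. Only `d` trilinear terms
  -- remain instead of `d²`, so Cauchy–Schwarz costs `√d`, which makes the final bound linear in
  -- `RS`.
  obtain ⟨V, l, hV, hl⟩ := exists_orthogonal_diagonalization (M := R * H * Rᵀ) (by
    simp only [Matrix.transpose_mul, Matrix.transpose_transpose, hH, Matrix.mul_assoc])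
  set P := Q * V with hP
  have hPP : Pᵀ * P = 1 := by
    calc Pᵀ * P = Vᵀ * (Qᵀ * Q) * V := by simp only [hP, Matrix.transpose_mul, Matrix.mul_assoc]
      _ = 1 := by rw [hQ, Matrix.mul_one, hV]
  have e1 : Q * R * H * (Q * R)ᵀ = P * Matrix.diagonal l * Pᵀ := by
    calc Q * R * H * (Q * R)ᵀ = Q * (R * H * Rᵀ) * Qᵀ := by
          simp only [Matrix.transpose_mul, Matrix.mul_assoc]
      _ = _ := by rw [hl]; simp only [hP, Matrix.transpose_mul, Matrix.mul_assoc]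
  rw [e1, frobSq_conj_of_orthonormal hPP]
  have e2 : ∑ t, frobInner (E t) (P * Matrix.diagonal l * Pᵀ)
      = ∑ a, trilin E (fun i => l a * P i a) (fun j => P j a) (fun _ => 1) := by
    rw [Finset.sum_congr rfl fun t _ => frobInner_conj _ _ _, Finset.sum_comm]
    refine Finset.sum_congr rfl fun a _ => ?_
    rw [trilin_eq]
    refine Finset.sum_congr rfl fun t _ => ?_
    rw [Finset.sum_eq_single a (fun b _ hb => by simp [hb.symm])
      (by simp), Matrix.diagonal_apply_eq, one_mul]
    simp only [Finset.mul_sum, mul_assoc]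
  have e3 (a : Fin d) : trilin E (fun i => l a * P i a) (fun j => P j a) (fun _ => 1)
      ≤ L * √T * |l a| := by
    have := hE (fun i => l a * P i a) (fun j => P j a) (fun _ => 1)
    simp only [mul_pow, ← Finset.mul_sum, sum_sq_col_of_orthonormal hPP, mul_one,
      Real.sqrt_sq_eq_abs, Real.sqrt_one, one_pow, Finset.sum_const, Finset.card_univ,
      Fintype.card_fin, nsmul_eq_mul] at this
    linarith
  have e4 : frobSq (Matrix.diagonal l) = ∑ a, |l a| ^ 2 := by
    rw [frobSq_eq_trace, Matrix.diagonal_transpose, Matrix.diagonal_mul_diagonal,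
      Matrix.trace_diagonal]
    simp [sq]
  rw [e2, e4]
  refine (Finset.sum_le_sum fun a _ => e3 a).trans ?_
  rw [← Finset.mul_sum, mul_assoc (L * √T)]
  refine mul_le_mul_of_nonneg_left ?_ (by positivity)
  have e5 := Real.sum_mul_le_sqrt_mul_sqrt (Finset.univ : Finset (Fin d)) (fun _ => 1)
    (fun a => |l a|)
  simp only [one_mul, one_pow, Finset.sum_const, Finset.card_univ, Fintype.card_fin,
    nsmul_eq_mul, mul_one] at e5
  refine e5.trans ?_
  gcongr

/-! ### Discretization of the sphere -/

/-- A finite subset of the ball of radius `2`, of cardinality at most `5 ^ n`, that determines the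
Euclidean norm by duality. -/
lemma exists_norming_finset (n : ℕ) : ∃ s : Finset (Fin n → ℝ), s.card ≤ 5 ^ n ∧
    (∀ c ∈ s, ∑ i, c i ^ 2 ≤ 4) ∧
    ∀ (a : Fin n → ℝ) (m : ℝ), (∀ c ∈ s, ∑ i, a i * c i ≤ m) →
      ∀ x : Fin n → ℝ, ∑ i, a i * x i ≤ m * √(∑ i, x i ^ 2) := by
  classical
  let F := EuclideanSpace ℝ (Fin n)
  let good : Finset F → Prop := fun s => (∀ c ∈ s, ‖c‖ ≤ 2) ∧
    ∀ c ∈ s, ∀ d ∈ s, c ≠ d → 1 ≤ ‖c - d‖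
  have hcard (s : Finset F) (hs : good s) : s.card ≤ 5 ^ n := by
    simpa [F] using Besicovitch.card_le_of_separated s hs.1 hs.2
  let p : ℕ → Prop := fun k => ∃ s : Finset F, good s ∧ s.card = k
  have hp0 : p 0 := ⟨∅, ⟨by simp, by simp⟩, rfl⟩
  -- A 1-separated subset of the ball of maximal cardinality; maximality makes it a 1-net of the
  -- ball.
  obtain ⟨s, hs, hsk⟩ : p (Nat.findGreatest p (5 ^ n)) :=
    Nat.findGreatest_spec (Nat.zero_le _) hp0
  have hmax (s' : Finset F) (hs' : good s') : s'.card ≤ s.card := by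
    rw [hsk]
    exact Nat.le_findGreatest (hcard s' hs') ⟨s', hs', rfl⟩
  have hcover (x : F) (hx : ‖x‖ ≤ 2) : ∃ c ∈ s, ‖x - c‖ ≤ 1 := by
    by_contra! hcon
    have hxs : x ∉ s := fun h => by simpa using (hcon x h).trans' zero_lt_one
    have : good (insert x s) := by
      refine ⟨fun c hc => ?_, fun c hc d hd hcd => ?_⟩
      · rcases Finset.mem_insert.1 hc with rfl | hc'
        · exact hx
        · exact hs.1 c hc'
      · rcases Finset.mem_insert.1 hc with rfl | hc' <;>
          rcases Finset.mem_insert.1 hd with rfl | hd'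
        · exact absurd rfl hcd
        · exact (hcon d hd').le
        · rw [norm_sub_rev]; exact (hcon c hc').le
        · exact hs.2 c hc' d hd' hcd
    have := hmax _ this
    rw [Finset.card_insert_of_notMem hxs] at this
    omega
  refine ⟨s.image WithLp.ofLp, Finset.card_image_le.trans (hcard s hs), ?_, ?_⟩
  · intro c hc
    obtain ⟨c, hcs, rfl⟩ := Finset.mem_image.1 hc
    rw [← EuclideanSpace.real_norm_sq_eq]
    nlinarith [hs.1 c hcs, norm_nonneg c]
  · intro a m ha x
    have hin (u w : F) : inner ℝ u w = ∑ i, u i * w i := by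
      rw [PiLp.inner_apply]
      exact Finset.sum_congr rfl fun i _ => by simp [mul_comm]
    let a' : F := WithLp.toLp 2 a
    have hm : ‖a'‖ ≤ m := by
      -- The net is tested at the vector of length 2 in the direction of `a'`: a net point within
      -- distance 1 still has inner product at least `2‖a'‖ - ‖a'‖ = ‖a'‖`. The radius 2 thus avoids
      -- any loss in the constant.
      obtain ⟨c, hc, hcx⟩ := hcover ((2 * ‖a'‖⁻¹) • a') (by
        rw [norm_smul, norm_mul, norm_inv, norm_norm, Real.norm_ofNat, mul_assoc]
        nlinarith [inv_mul_le_one (a := ‖a'‖)])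
      have h1 := ha c (Finset.mem_image_of_mem _ hc)
      have h2 : inner ℝ a' c ≤ m := by rw [hin]; exact h1
      have h3 : inner ℝ a' ((2 * ‖a'‖⁻¹) • a' - c) ≤ ‖a'‖ :=
        (real_inner_le_norm _ _).trans (mul_le_of_le_one_right (norm_nonneg _) hcx)
      have h4 : inner ℝ a' ((2 * ‖a'‖⁻¹) • a') = 2 * ‖a'‖ := by
        rw [real_inner_smul_right, real_inner_self_eq_norm_sq]
        rcases eq_or_ne ‖a'‖ 0 with h | h
        · simp [h]
        · field_simp
      rw [inner_sub_right, h4] at h3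
      linarith
    have h1 : ∑ i, a i * x i = inner ℝ a' (WithLp.toLp 2 x : F) := by rw [hin]
    have h2 : √(∑ i, x i ^ 2) = ‖(WithLp.toLp 2 x : F)‖ := by
      rw [EuclideanSpace.norm_eq]; simp
    rw [h1, h2]
    exact (real_inner_le_norm _ _).trans (by gcongr)

/-- A trilinear form is bounded as soon as it is bounded on the product of three norming sets. -/
lemma trilinBound_of_norming {N T : ℕ} {s : Finset (Fin N → ℝ)} {r : Finset (Fin T → ℝ)}
    (hs : ∀ (a : Fin N → ℝ) (m : ℝ), (∀ c ∈ s, ∑ i, a i * c i ≤ m) →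
      ∀ x : Fin N → ℝ, ∑ i, a i * x i ≤ m * √(∑ i, x i ^ 2))
    (hr : ∀ (a : Fin T → ℝ) (m : ℝ), (∀ c ∈ r, ∑ i, a i * c i ≤ m) →
      ∀ x : Fin T → ℝ, ∑ i, a i * x i ≤ m * √(∑ i, x i ^ 2))
    {E : Fin T → Matrix (Fin N) (Fin N) ℝ} {L : ℝ}
    (h : ∀ x ∈ s, ∀ y ∈ s, ∀ z ∈ r, trilin E x y z ≤ L) : TrilinBound E L := by
  have e1 (x y : Fin N → ℝ) (z : Fin T → ℝ) :
      trilin E x y z = ∑ i, (∑ t, ∑ j, z t * y j * E t i j) * x i := by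
    simp only [trilin, Finset.sum_mul]
    rw [Finset.sum_comm]
    exact Finset.sum_congr rfl fun i _ => Finset.sum_congr rfl fun t _ =>
      Finset.sum_congr rfl fun j _ => by ring
  have e2 (x y : Fin N → ℝ) (z : Fin T → ℝ) :
      trilin E x y z = ∑ j, (∑ t, ∑ i, z t * x i * E t i j) * y j := by
    simp only [trilin, Finset.sum_mul]
    rw [Finset.sum_comm (s := (Finset.univ : Finset (Fin N))) (t := (Finset.univ : Finset (Fin T)))]
    refine Finset.sum_congr rfl fun t _ => ?_
    rw [Finset.sum_comm]
    exact Finset.sum_congr rfl fun j _ => Finset.sum_congr rfl fun i _ => by ring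
  have e3 (x y : Fin N → ℝ) (z : Fin T → ℝ) :
      trilin E x y z = ∑ t, (∑ i, ∑ j, x i * y j * E t i j) * z t := by
    rw [trilin_eq]
    exact Finset.sum_congr rfl fun t _ => mul_comm _ _
  -- The arguments are released from the norming sets one at a time, using linearity in each.
  have h1 (y) (hy : y ∈ s) (z) (hz : z ∈ r) (x : Fin N → ℝ) :
      trilin E x y z ≤ L * √(∑ i, x i ^ 2) := by
    rw [e1]
    exact hs _ _ (fun c hc => by rw [← e1]; exact h c hc y hy z hz) x
  have h2 (z) (hz : z ∈ r) (x y : Fin N → ℝ) :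
      trilin E x y z ≤ L * √(∑ i, x i ^ 2) * √(∑ i, y i ^ 2) := by
    rw [e2]
    exact hs _ _ (fun c hc => by rw [← e2]; exact h1 c hc z hz x) y
  intro x y z
  rw [e3]
  exact hr _ _ (fun c hc => by rw [← e3]; exact h2 c hc x y) z

/-! ### Concentration of the noise -/

/-- Only the entries above the diagonal are independent, so sums over all entries are regrouped into
symmetric pairs and a diagonal part. -/
lemma sum_upper_add_sum_lower_add_sum_diag {N T : ℕ} (f : Fin T → Fin N → Fin N → ℝ) :
    ∑ e : {e : Fin T × Fin N × Fin N // e.2.1 < e.2.2},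
        (f e.1.1 e.1.2.1 e.1.2.2 + f e.1.1 e.1.2.2 e.1.2.1) + ∑ t, ∑ i, f t i i =
      ∑ t, ∑ i, ∑ j, f t i j := by
  have h1 : ∑ e : {e : Fin T × Fin N × Fin N // e.2.1 < e.2.2},
        (f e.1.1 e.1.2.1 e.1.2.2 + f e.1.1 e.1.2.2 e.1.2.1) =
      ∑ t, ∑ i, ∑ j, if i < j then f t i j + f t j i else 0 := by
    rw [← Finset.sum_subtype (Finset.univ.filter fun e : Fin T × Fin N × Fin N => e.2.1 < e.2.2)
      (by simp) (fun e => f e.1 e.2.1 e.2.2 + f e.1 e.2.2 e.2.1), Finset.sum_filter,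
      Fintype.sum_prod_type]
    exact Finset.sum_congr rfl fun t _ => Fintype.sum_prod_type _
  rw [h1, ← Finset.sum_add_distrib]
  refine Finset.sum_congr rfl fun t _ => ?_
  have h2 : ∑ i, ∑ j, (if i < j then f t i j + f t j i else 0)
      = ∑ i, ∑ j, ((if i < j then f t i j else 0) + if j < i then f t i j else 0) := by
    have h3 : ∑ i, ∑ j, (if i < j then f t j i else 0)
        = ∑ i, ∑ j, if j < i then f t i j else 0 := Finset.sum_comm
    simp only [Finset.sum_add_distrib]
    rw [← h3, ← Finset.sum_add_distrib]
    refine Finset.sum_congr rfl fun i _ => ?_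
    rw [← Finset.sum_add_distrib]
    exact Finset.sum_congr rfl fun j _ => by split_ifs <;> simp
  rw [h2, ← Finset.sum_add_distrib]
  refine Finset.sum_congr rfl fun i _ => ?_
  have h4 : f t i i = ∑ j, if j = i then f t i j else 0 := by simp
  rw [h4, ← Finset.sum_add_distrib]
  refine Finset.sum_congr rfl fun j _ => ?_
  rcases lt_trichotomy i j with h | h | h
  · simp [h, h.not_gt, h.ne']
  · simp [h]
  · simp [h, h.not_gt, h.ne]

/-- The deviation of adjacency matrices from their edge probabilities under `q`. -/
noncomputable def noise {N T K RS RD : ℕ} (q : Param N T K RS RD) (A : Fin T → Matrix (Fin N) (Fin N) ℝ)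
    (t : Fin T) : Matrix (Fin N) (Fin N) ℝ :=
  Matrix.of fun i j => A t i j - Real.sigmoid (q.Theta t i j)

lemma Param.Theta_symm {N T K RS RD : ℕ} (p : Param N T K RS RD) (t : Fin T) (i j : Fin N) :
    p.Theta t i j = p.Theta t j i := by
  have : (p.Theta t)ᵀ = p.Theta t := by
    simp [Param.Theta, Param.S, Param.D, Matrix.mul_assoc]
  exact (congrFun (congrFun this i) j).symm

section Sample

variable {N T K RS RD : ℕ} {Ω : Type*} [MeasurableSpace Ω] {μ : Measure Ω}
  [IsProbabilityMeasure μ] {q : Param N T K RS RD} {A : Fin T → Ω → Matrix (Fin N) (Fin N) ℝ}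

/-- Hoeffding's lemma for a variable in `[0, 1]`: the variance proxy is `(1/2)²`. -/
lemma IsNetworkSample.hasSubgaussianMGF (hA : IsNetworkSample μ q A) (t : Fin T) {i j : Fin N}
    (hij : i < j) :
    HasSubgaussianMGF (fun ω => A t ω i j - Real.sigmoid (q.Theta t i j)) (1 / 4) μ := by
  have hint : ∫ ω, A t ω i j ∂μ = Real.sigmoid (q.Theta t i j) := by
    rw [← hA.prob_edge t i j hij]
    have hs : MeasurableSet {ω | A t ω i j = 1} :=
      hA.measurable t i j (measurableSet_singleton 1)
    rw [← integral_indicator_one hs]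
    refine integral_congr_ae (Filter.Eventually.of_forall fun ω => ?_)
    rcases (hA.isAdjMatrix t ω).zero_or_one i j with h | h <;> simp [Set.indicator, h]
  have h := hasSubgaussianMGF_of_mem_Icc (a := 0) (b := 1) (hA.measurable t i j).aemeasurable
    (μ := μ) (Filter.Eventually.of_forall fun ω => by
      rcases (hA.isAdjMatrix t ω).zero_or_one i j with h | h <;> simp [h])
  rw [hint] at h
  convert h using 1
  norm_num

/-- The off-diagonal part is a weighted sum of independent sub-Gaussian variables. The diagonal
noise is the deterministic `-σ(Θᵢᵢ)`, of size at most 1, and contributes at most `2√T · 4 = 8√T`. -/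
lemma IsNetworkSample.trilin_noise_tail (hA : IsNetworkSample μ q A) {x y : Fin N → ℝ}
    {z : Fin T → ℝ} (hx : ∑ i, x i ^ 2 ≤ 4) (hy : ∑ i, y i ^ 2 ≤ 4) (hz : ∑ t, z t ^ 2 ≤ 4)
    {s : ℝ} (hs : 0 ≤ s) :
    μ.real {ω | s + 8 * √T ≤ trilin (noise q fun t => A t ω) x y z} ≤
      Real.exp (-s ^ 2 / 64) := by
  let c : {e : Fin T × Fin N × Fin N // e.2.1 < e.2.2} → ℝ :=
    fun e => z e.1.1 * (x e.1.2.1 * y e.1.2.2 + x e.1.2.2 * y e.1.2.1)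
  let X : {e : Fin T × Fin N × Fin N // e.2.1 < e.2.2} → Ω → ℝ :=
    fun e ω => c e * (A e.1.1 ω e.1.2.1 e.1.2.2 - Real.sigmoid (q.Theta e.1.1 e.1.2.1 e.1.2.2))
  have hXi : iIndepFun X μ :=
    hA.indep.comp (fun e a => c e * (a - Real.sigmoid (q.Theta e.1.1 e.1.2.1 e.1.2.2)))
      (fun e => by fun_prop)
  have hX (e) : HasSubgaussianMGF (X e) (‖c e‖₊ ^ 2 * (1 / 4)) μ := by
    convert (hA.hasSubgaussianMGF e.1.1 e.2).const_mul (c e) using 2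
    exact congrArg (· * (1 / 4 : NNReal)) (NNReal.eq (by simp; rfl))
  have hsub := HasSubgaussianMGF.sum_of_iIndepFun hXi (s := Finset.univ) (fun e _ => hX e)
  -- `128 = 2 · 4³`, with the 2 from `(a + b)² ≤ 2a² + 2b²`; multiplied by `1/4` it gives the
  -- variance proxy 32.
  have hc : ∑ e, c e ^ 2 ≤ 128 := by
    have h1 : ∑ e, c e ^ 2 ≤ ∑ e : {e : Fin T × Fin N × Fin N // e.2.1 < e.2.2},
        (2 * z e.1.1 ^ 2 * x e.1.2.1 ^ 2 * y e.1.2.2 ^ 2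
          + 2 * z e.1.1 ^ 2 * x e.1.2.2 ^ 2 * y e.1.2.1 ^ 2) := by
      refine Finset.sum_le_sum fun e _ => ?_
      have := mul_nonneg (sq_nonneg (z e.1.1))
        (sq_nonneg (x e.1.2.1 * y e.1.2.2 - x e.1.2.2 * y e.1.2.1))
      simp only [c]
      nlinarith
    have h2 := sum_upper_add_sum_lower_add_sum_diag
      (fun (t : Fin T) (i j : Fin N) => 2 * z t ^ 2 * x i ^ 2 * y j ^ 2)
    have h3 : 0 ≤ ∑ t, ∑ i, 2 * z t ^ 2 * x i ^ 2 * y i ^ 2 :=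
      Finset.sum_nonneg fun t _ => Finset.sum_nonneg fun i _ => by positivity
    have h4 : ∑ t, ∑ i, ∑ j, 2 * z t ^ 2 * x i ^ 2 * y j ^ 2
        = 2 * ((∑ t, z t ^ 2) * ((∑ i, x i ^ 2) * ∑ j, y j ^ 2)) := by
      rw [Finset.sum_mul_sum, Finset.sum_mul, Finset.mul_sum]
      refine Finset.sum_congr rfl fun t _ => ?_
      simp only [Finset.mul_sum, mul_assoc]
    have h5 : (∑ i, x i ^ 2) * ∑ j, y j ^ 2 ≤ 4 * 4 :=
      mul_le_mul hx hy (Finset.sum_nonneg fun _ _ => sq_nonneg _) (by norm_num)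
    have h6 : (∑ t, z t ^ 2) * ((∑ i, x i ^ 2) * ∑ j, y j ^ 2) ≤ 4 * (4 * 4) :=
      mul_le_mul hz h5 (mul_nonneg (Finset.sum_nonneg fun _ _ => sq_nonneg _)
        (Finset.sum_nonneg fun _ _ => sq_nonneg _)) (by norm_num)
    linarith
  have hsub32 : HasSubgaussianMGF (fun ω => ∑ e, X e ω) 32 μ := by
    refine ⟨hsub.integrable_exp_mul, fun u => (hsub.mgf_le u).trans ?_⟩
    rw [Real.exp_le_exp]
    have h1 : ((∑ e, ‖c e‖₊ ^ 2 * (1 / 4) : NNReal) : ℝ) = (∑ e, c e ^ 2) * (1 / 4) := by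
      rw [Finset.sum_mul, NNReal.coe_sum]
      exact Finset.sum_congr rfl fun e _ => by simp
    rw [h1]
    have h2 : (∑ e, c e ^ 2) * (1 / 4) ≤ ((32 : NNReal) : ℝ) := by
      push_cast
      linarith
    gcongr
  have hdecomp (ω : Ω) : trilin (noise q fun t => A t ω) x y z ≤ ∑ e, X e ω + 8 * √T := by
    rw [trilin, ← sum_upper_add_sum_lower_add_sum_diag]
    refine add_le_add (le_of_eq (Finset.sum_congr rfl fun e _ => ?_)) ?_
    · have hsymm : A e.1.1 ω e.1.2.2 e.1.2.1 = A e.1.1 ω e.1.2.1 e.1.2.2 :=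
        (hA.isAdjMatrix e.1.1 ω).symm.apply _ _
      simp only [noise, Matrix.of_apply, X, c, hsymm, q.Theta_symm e.1.1 e.1.2.2 e.1.2.1]
      ring
    · have h1 (t : Fin T) (i : Fin N) :
          z t * x i * y i * noise q (fun t => A t ω) t i i ≤ |z t| * (|x i| * |y i|) := by
        refine (le_abs_self _).trans ?_
        rw [abs_mul, abs_mul, abs_mul, ← mul_assoc]
        refine mul_le_of_le_one_right (by positivity) ?_
        simp only [noise, Matrix.of_apply, (hA.isAdjMatrix t ω).apply_diag, zero_sub, abs_neg]
        rw [abs_of_pos (Real.sigmoid_pos _)]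
        exact Real.sigmoid_le_one _
      refine (Finset.sum_le_sum fun t _ => Finset.sum_le_sum fun i _ => h1 t i).trans ?_
      rw [← Finset.sum_mul_sum]
      have sqrt4 {u : ℝ} (hu : u ≤ 4) : √u ≤ 2 := by
        rw [show (2 : ℝ) = √4 by rw [show (4 : ℝ) = 2 ^ 2 by norm_num]; simp]
        exact Real.sqrt_le_sqrt hu
      have h2 := Real.sum_mul_le_sqrt_mul_sqrt Finset.univ (fun i => |x i|) (fun i => |y i|)
      have h3 := Real.sum_mul_le_sqrt_mul_sqrt Finset.univ (fun t => |z t|) (fun _ => 1)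
      simp only [sq_abs, mul_one, one_pow, Finset.sum_const, Finset.card_univ, Fintype.card_fin,
        nsmul_eq_mul] at h2 h3
      have h4 : ∑ i, |x i| * |y i| ≤ 2 * 2 :=
        h2.trans (mul_le_mul (sqrt4 hx) (sqrt4 hy) (by positivity) (by norm_num))
      have h5 : ∑ t, |z t| ≤ 2 * √T := h3.trans (by gcongr; exact sqrt4 hz)
      calc (∑ t, |z t|) * ∑ i, |x i| * |y i| ≤ (2 * √T) * (2 * 2) := by gcongr
        _ = 8 * √T := by ring
  calc μ.real {ω | s + 8 * √T ≤ trilin (noise q fun t => A t ω) x y z}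
      ≤ μ.real {ω | s ≤ ∑ e, X e ω} := by
        refine measureReal_mono fun ω hω => ?_
        have h1 : s + 8 * √T ≤ trilin (noise q fun t => A t ω) x y z := hω
        have h2 := hdecomp ω
        change s ≤ ∑ e, X e ω
        linarith
    _ ≤ Real.exp (-s ^ 2 / (2 * (32 : NNReal))) := hsub32.measure_ge_le hs
    _ = Real.exp (-s ^ 2 / 64) := by norm_num

/-- The noise tensor has spectral norm of order `√(2N + T)` with high probability. -/
lemma IsNetworkSample.trilinBound_noise (hA : IsNetworkSample μ q A) :
    1 - Real.exp (-(2 * N + T)) ≤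
      μ.real {ω | TrilinBound (noise q fun t => A t ω) (24 * √(2 * N + T))} := by
  obtain ⟨s, hscard, hs4, hs⟩ := exists_norming_finset N
  obtain ⟨r, hrcard, hr4, hr⟩ := exists_norming_finset T
  set n : ℝ := 2 * N + T with hn
  have hn0 : 0 ≤ n := by positivity
  set G := {ω | TrilinBound (noise q fun t => A t ω) (24 * √n)} with hG
  have hTn : √T ≤ √n := Real.sqrt_le_sqrt (by rw [hn]; linarith [N.cast_nonneg (α := ℝ)])
  -- `24 = 16 + 8`: the 8 absorbs the diagonal, and deviation `16√n` has tail `exp(-4n)`, which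
  -- beats the net cardinality `5^(2N+T) ≤ exp(3n)`.
  have hcompl : Gᶜ ⊆ ⋃ p ∈ s ×ˢ s ×ˢ r, {ω | 16 * √n + 8 * √T ≤
      trilin (noise q fun t => A t ω) p.1 p.2.1 p.2.2} := by
    intro ω hω
    by_contra hcon
    refine hω (trilinBound_of_norming hs hr fun x hx y hy z hz => ?_)
    simp only [Set.mem_iUnion, Set.mem_ofPred_eq, not_exists, not_le] at hcon
    have := hcon (x, y, z) (by simp [hx, hy, hz])
    simp only at this
    linarith
  have hb : μ.real Gᶜ ≤ Real.exp (-n) := by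
    calc μ.real Gᶜ ≤ μ.real (⋃ p ∈ s ×ˢ s ×ˢ r, {ω | 16 * √n + 8 * √T ≤
          trilin (noise q fun t => A t ω) p.1 p.2.1 p.2.2}) :=
          measureReal_mono hcompl (measure_ne_top _ _)
      _ ≤ ∑ p ∈ s ×ˢ s ×ˢ r, μ.real {ω | 16 * √n + 8 * √T ≤
          trilin (noise q fun t => A t ω) p.1 p.2.1 p.2.2} := measureReal_biUnion_finset_le _ _
      _ ≤ ∑ p ∈ s ×ˢ s ×ˢ r, Real.exp (-(16 * √n) ^ 2 / 64) := by
          refine Finset.sum_le_sum fun p hp => ?_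
          simp only [Finset.mem_product] at hp
          exact hA.trilin_noise_tail (hs4 _ hp.1) (hs4 _ hp.2.1) (hr4 _ hp.2.2) (by positivity)
      _ = (s.card * (s.card * r.card) : ℕ) * Real.exp (-(4 * n)) := by
          rw [Finset.sum_const, Finset.card_product, Finset.card_product, nsmul_eq_mul, mul_pow,
            Real.sq_sqrt hn0]
          congr 2
          ring
      _ ≤ (5 ^ N * (5 ^ N * 5 ^ T) : ℕ) * Real.exp (-(4 * n)) := by gcongr
      _ ≤ Real.exp (3 * n) * Real.exp (-(4 * n)) := by
          gcongr
          have h5 : (5 : ℝ) ≤ Real.exp 3 := by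
            have h := Real.exp_one_gt_d9
            rw [show (3 : ℝ) = 1 + 1 + 1 by norm_num, Real.exp_add, Real.exp_add]
            nlinarith [mul_pos (Real.exp_pos 1) (Real.exp_pos 1)]
          have h6 : 3 * n = ((N + (N + T) : ℕ) : ℝ) * 3 := by rw [hn]; push_cast; ring
          rw [h6, Real.exp_nat_mul, ← pow_add, ← pow_add]
          push_cast
          exact pow_le_pow_left₀ (by norm_num) h5 _
      _ = Real.exp (-n) := by rw [← Real.exp_add]; ring_nf
  -- Subadditivity suffices here, so measurability of `G` is not needed.
  have h1 : 1 ≤ μ.real G + μ.real Gᶜ := by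
    have := measureReal_union_le (μ := μ) G Gᶜ
    rwa [Set.union_compl_self, probReal_univ] at this
  linarith

end Sample

/-! ### Deterministic analysis of the estimator -/

section Deterministic

variable {N T K RS RD : ℕ}

lemma frobInner_add {m n : ℕ} (E M M' : Matrix (Fin m) (Fin n) ℝ) :
    frobInner E (M + M') = frobInner E M + frobInner E M' := by
  simp only [frobInner, Matrix.add_apply, mul_add, Finset.sum_add_distrib]

lemma frobSq_add {m n : ℕ} (M M' : Matrix (Fin m) (Fin n) ℝ) :
    frobSq (M + M') = frobSq M + 2 * frobInner M M' + frobSq M' := by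
  simp only [frobSq, frobInner, Matrix.add_apply, Finset.mul_sum, ← Finset.sum_add_distrib]
  exact Finset.sum_congr rfl fun i _ => Finset.sum_congr rfl fun j _ => by ring

/-- The basic inequality of maximum likelihood estimation. -/
lemma basic_inequality {τ : ℝ} {p q : Param N T K RS RD} {A : Fin T → Matrix (Fin N) (Fin N) ℝ}
    (hp : ∀ t i j, |p.Theta t i j| ≤ τ) (hq : ∀ t i j, |q.Theta t i j| ≤ τ)
    (h : p.negLogLik A ≤ q.negLogLik A) :
    Real.sigmoid (-τ) ^ 2 / 2 * ∑ t, frobSq (p.Theta t - q.Theta t) ≤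
      ∑ t, frobInner (noise q A t) (p.Theta t - q.Theta t) := by
  have h1 : ∑ t, ∑ i, ∑ j, Real.sigmoid (-τ) ^ 2 / 2 * (p.Theta t i j - q.Theta t i j) ^ 2 ≤
      ∑ t, ∑ i, ∑ j, (Real.log (1 + Real.exp (p.Theta t i j))
        - Real.log (1 + Real.exp (q.Theta t i j))
        - Real.sigmoid (q.Theta t i j) * (p.Theta t i j - q.Theta t i j)) :=
    Finset.sum_le_sum fun t _ => Finset.sum_le_sum fun i _ => Finset.sum_le_sum fun j _ =>
      strongConvexity_log_one_add_exp (hq t i j) (hp t i j)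
  -- The Bregman divergence of the logistic loss is the excess negative log-likelihood plus a term
  -- linear in the noise.
  have h2 : ∑ t, ∑ i, ∑ j, (Real.log (1 + Real.exp (p.Theta t i j))
        - Real.log (1 + Real.exp (q.Theta t i j))
        - Real.sigmoid (q.Theta t i j) * (p.Theta t i j - q.Theta t i j)) =
      ∑ t, frobInner (noise q A t) (p.Theta t - q.Theta t)
        + (p.negLogLik A - q.negLogLik A) := by
    simp only [frobInner, noise, Param.negLogLik, Matrix.of_apply, Matrix.sub_apply,
      ← Finset.sum_neg_distrib, ← Finset.sum_sub_distrib, ← Finset.sum_add_distrib]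
    exact Finset.sum_congr rfl fun t _ => Finset.sum_congr rfl fun i _ =>
      Finset.sum_congr rfl fun j _ => by ring
  have h3 : Real.sigmoid (-τ) ^ 2 / 2 * ∑ t, frobSq (p.Theta t - q.Theta t) =
      ∑ t, ∑ i, ∑ j, Real.sigmoid (-τ) ^ 2 / 2 * (p.Theta t i j - q.Theta t i j) ^ 2 := by
    simp only [frobSq, Finset.mul_sum, Matrix.sub_apply]
  rw [h3]
  linarith

lemma Theta_sub_Theta (p q : Param N T K RS RD) (t : Fin T) :
    p.Theta t - q.Theta t = (p.S - q.S) + (p.D t - q.D t) := by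
  simp only [Param.Theta]
  abel

/-- Centering makes the time-invariant and the time-varying errors orthogonal. -/
lemma sum_frobSq_Theta_sub {p q : Param N T K RS RD} (hp : ∑ t, p.D t = 0)
    (hq : ∑ t, q.D t = 0) :
    ∑ t, frobSq (p.Theta t - q.Theta t) =
      T * frobSq (p.S - q.S) + ∑ t, frobSq (p.D t - q.D t) := by
  have h0 : ∑ t, frobInner (p.S - q.S) (p.D t - q.D t) = 0 := by
    have h1 : ∑ t, frobInner (p.S - q.S) (p.D t - q.D t)
        = frobInner (p.S - q.S) (∑ t, (p.D t - q.D t)) := by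
      simp only [frobInner_eq_trace, Matrix.mul_sum, Matrix.trace_sum]
    rw [h1, Finset.sum_sub_distrib, hp, hq, sub_zero]
    simp [frobInner]
  simp only [Theta_sub_Theta, frobSq_add, Finset.sum_add_distrib, ← Finset.mul_sum, h0]
  simp

/-- The difference factors as `[Z, Z'] diag(I, -I) [Z, Z']ᵀ`, with `2 RS` columns and no dependence
on time. -/
lemma TrilinBound.sum_frobInner_S_le {E : Fin T → Matrix (Fin N) (Fin N) ℝ} {L : ℝ}
    (hE : TrilinBound E L) (hL : 0 ≤ L) (p q : Param N T K RS RD) :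
    ∑ t, frobInner (E t) (p.S - q.S) ≤ L * √T * √(2 * RS) * √(frobSq (p.S - q.S)) := by
  have h := hE.sum_frobInner_const_le hL (Matrix.fromCols p.Z q.Z)
    (H := Matrix.fromBlocks 1 0 0 (-1)) (by simp [Matrix.fromBlocks_transpose])
  have e : Matrix.fromCols p.Z q.Z *
      (Matrix.fromBlocks 1 0 0 (-1) : Matrix (Fin RS ⊕ Fin RS) (Fin RS ⊕ Fin RS) ℝ) *
      (Matrix.fromCols p.Z q.Z)ᵀ
      = p.S - q.S := by
    rw [Matrix.transpose_fromCols, Matrix.fromCols_mul_fromBlocks, Matrix.fromCols_mul_fromRows]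
    simp [Param.S, sub_eq_add_neg]
  rw [e] at h
  refine h.trans_eq ?_
  simp [two_mul]

/-- Time points are sorted by the pair of labels under `p` and `q`. Within a cell both frames are
fixed, so the differences share a factor with `2 RD` columns; Cauchy–Schwarz over the `K²` cells
costs `K`. The two labelings need not be matched. -/
lemma TrilinBound.sum_frobInner_D_le {E : Fin T → Matrix (Fin N) (Fin N) ℝ} {L : ℝ}
    (hE : TrilinBound E L) (hL : 0 ≤ L) (p q : Param N T K RS RD) :
    ∑ t, frobInner (E t) (p.D t - q.D t) ≤
      2 * L * RD * K * √(∑ t, frobSq (p.D t - q.D t)) := by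
  let X : Fin K × Fin K → Fin T → Matrix (Fin N) (Fin N) ℝ := fun c t =>
    if (p.g t, q.g t) = c then p.D t - q.D t else 0
  have hcell (c : Fin K × Fin K) :
      ∑ t, frobInner (E t) (X c t) ≤ L * (2 * RD) * √(∑ t, frobSq (X c t)) := by
    have h := hE.sum_frobInner_le hL (Matrix.fromCols (p.U c.1) (q.U c.2))
      (fun t => if (p.g t, q.g t) = c then
        Matrix.fromBlocks (Matrix.diagonal (p.v t)) 0 0 (-Matrix.diagonal (q.v t)) else 0)
    have e (t : Fin T) : Matrix.fromCols (p.U c.1) (q.U c.2) * (if (p.g t, q.g t) = c then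
        Matrix.fromBlocks (Matrix.diagonal (p.v t)) 0 0 (-Matrix.diagonal (q.v t)) else 0)
        * (Matrix.fromCols (p.U c.1) (q.U c.2))ᵀ = X c t := by
      by_cases hc : (p.g t, q.g t) = c
      · simp only [X, if_pos hc]
        subst hc
        rw [Matrix.transpose_fromCols, Matrix.fromCols_mul_fromBlocks,
          Matrix.fromCols_mul_fromRows]
        simp only [Param.D, sub_eq_add_neg, Matrix.mul_zero, add_zero, zero_add, Matrix.mul_neg,
          Matrix.neg_mul]
      · simp only [X, if_neg hc, Matrix.mul_zero, Matrix.zero_mul]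
    simp only [e] at h
    refine h.trans_eq ?_
    simp [two_mul]
  have hsum (F : Fin T → Matrix (Fin N) (Fin N) ℝ → ℝ) (hF : ∀ t, F t 0 = 0) :
      ∑ c, ∑ t, F t (X c t) = ∑ t, F t (p.D t - q.D t) := by
    rw [Finset.sum_comm]
    refine Finset.sum_congr rfl fun t _ => ?_
    simp only [X, apply_ite (F t), hF, Finset.sum_ite_eq, Finset.mem_univ, if_true]
  rw [← hsum (fun t M => frobInner (E t) M) (fun t => by simp [frobInner]),
    ← hsum (fun _ M => frobSq M) (fun t => by simp [frobSq])]
  refine (Finset.sum_le_sum fun c _ => hcell c).trans ?_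
  rw [← Finset.mul_sum]
  have h1 := Real.sum_mul_le_sqrt_mul_sqrt (Finset.univ : Finset (Fin K × Fin K)) (fun _ => 1)
    (fun c => √(∑ t, frobSq (X c t)))
  have h2 : ∑ c, √(∑ t, frobSq (X c t)) ^ 2 = ∑ c, ∑ t, frobSq (X c t) :=
    Finset.sum_congr rfl fun c _ => Real.sq_sqrt (Finset.sum_nonneg fun t _ => frobSq_nonneg _)
  have h3 : √(∑ _c : Fin K × Fin K, (1 : ℝ) ^ 2) = K := by simp
  rw [h2, h3] at h1
  simp only [one_mul] at h1
  calc L * (2 * RD) * ∑ c, √(∑ t, frobSq (X c t))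
      ≤ L * (2 * RD) * (K * √(∑ c, ∑ t, frobSq (X c t))) := by gcongr
    _ = _ := by ring

/-- The error bound for oracle estimators when the noise tensor has spectral norm at most `L`. -/
lemma Param.IsOracleEstimator.error_le {τ₁ τ₂ L : ℝ} {p q : Param N T K RS RD}
    {A : Fin T → Matrix (Fin N) (Fin N) ℝ} (hq : q.Admissible τ₁ τ₂)
    (hp : Param.IsOracleEstimator τ₁ τ₂ q A p) (hL : 0 ≤ L) (hE : TrilinBound (noise q A) L) :
    T * frobSq (p.S - q.S) + ∑ t, frobSq (p.D t - q.D t) ≤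
      2 * L ^ 2 / (Real.sigmoid (-τ₁) ^ 2 / 2) ^ 2 * (RS + 2 * RD ^ 2 * K ^ 2) := by
  -- The true parameter `q` satisfies its own support constraint and hence competes in the
  -- minimization.
  have hbasic := basic_inequality hp.1.1.bound_Theta hq.bound_Theta
    (hp.2 q ⟨hq, fun _ _ h => h⟩)
  rw [sum_frobSq_Theta_sub hp.1.1.centered hq.centered] at hbasic
  simp only [Theta_sub_Theta, frobInner_add, Finset.sum_add_distrib] at hbasic
  have hγ : 0 < Real.sigmoid (-τ₁) ^ 2 / 2 := by
    have := Real.sigmoid_pos (-τ₁)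
    positivity
  set γ := Real.sigmoid (-τ₁) ^ 2 / 2
  have hS := hE.sum_frobInner_S_le hL p q
  have hD := hE.sum_frobInner_D_le hL p q
  set a := √T * √(frobSq (p.S - q.S)) with ha
  set y := √(∑ t, frobSq (p.D t - q.D t)) with hy
  have ha2 : a ^ 2 = T * frobSq (p.S - q.S) := by
    rw [ha, mul_pow, Real.sq_sqrt (Nat.cast_nonneg _), Real.sq_sqrt (frobSq_nonneg _)]
  have hy2 : y ^ 2 = ∑ t, frobSq (p.D t - q.D t) :=
    Real.sq_sqrt (Finset.sum_nonneg fun t _ => frobSq_nonneg _)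
  have hr2 : √(2 * RS : ℝ) ^ 2 = 2 * RS := Real.sq_sqrt (by positivity)
  rw [← ha2, ← hy2] at hbasic ⊢
  have h1 : γ * (a ^ 2 + y ^ 2) ≤ L * √(2 * RS) * a + 2 * L * RD * K * y := by
    have : L * √T * √(2 * RS) * √(frobSq (p.S - q.S)) = L * √(2 * RS) * a := by rw [ha]; ring
    linarith
  rw [div_mul_eq_mul_div, le_div_iff₀ (by positivity)]
  -- Completing squares: `γ (a² + y²) ≤ b a + c y` implies `γ² (a² + y²) ≤ b² + c²`.
  have h2 := sq_nonneg (γ * a - L * √(2 * RS))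
  have h3 := sq_nonneg (γ * y - 2 * L * RD * K)
  have h4 := mul_le_mul_of_nonneg_left h1 (mul_nonneg zero_le_two hγ.le)
  have h5 : (L * √(2 * RS)) ^ 2 = 2 * L ^ 2 * RS := by rw [mul_pow, hr2]; ring
  nlinarith

end Deterministic

end STANE

/-! ### Choice of constants and conclusion -/

theorem corollary1 :
    -- absolute constants `c₁`, `c₂`; `C₂` depends on `τ₁` only, and `C₁` on `τ₁` and `δ` only
    ∃ c₁ > (0 : ℝ), ∃ c₂ > (0 : ℝ), ∀ τ₁ > (0 : ℝ), ∃ C₂ > (0 : ℝ), ∀ δ > (0 : ℝ),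
      ∃ C₁ > (0 : ℝ),
    ∀ (N T K RS RD : ℕ) (τ₂ κ : ℝ) (q : Param N T K RS RD)
      (Ω : Type*) [MeasurableSpace Ω] (μ : Measure Ω) [IsProbabilityMeasure μ]
      (A : Fin T → Ω → Matrix (Fin N) (Fin N) ℝ),
      1 ≤ T → (T : ℝ) ≤ δ * N → 0 < κ → κ ≤ τ₂ →
      q.Admissible τ₁ τ₂ → q.SignalBound κ → IsNetworkSample μ q A →
      1 - T * Real.exp (-(c₁ * N)) - Real.exp (-(c₂ * (2 * N + T))) ≤
        μ.real {ω | ∀ p : Param N T K RS RD,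
            Param.IsOracleEstimator τ₁ τ₂ q (fun t => A t ω) p →
          frobSq (p.Z * p.Z.transpose - q.Z * q.Z.transpose) ≤
              C₁ * N * RS / T + C₂ * K ^ 2 * RD ^ 2 * (2 * N + T) / T ∧
          ∀ k : Fin K, 0 < (q.group k).card →
            -- the error averaged over the time points of the true group `k`
            ((q.group k).card : ℝ)⁻¹ *
                ∑ t ∈ q.group k, alignedDist (p.U (p.g t)) (q.U k) ≤
              8 * (((q.group k).card : ℝ) * κ ^ 2)⁻¹ *
                (C₁ * RS + C₂ * (2 + δ) * K ^ 2 * RD ^ 2) ∧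
            -- the error at one estimated label `j` of a time point of the true group `k`;
            -- `j = k` if the estimated and the true labels agree on that group
            ∃ j ∈ (q.group k).image p.g,
              alignedDist (p.U j) (q.U k) ≤
                8 * (((q.group k).card : ℝ) * κ ^ 2)⁻¹ *
                  (C₁ * RS + C₂ * (2 + δ) * K ^ 2 * RD ^ 2)} := by
  refine ⟨1, one_pos, 1, one_pos, fun τ₁ _ => ?_⟩
  have hγ : 0 < Real.sigmoid (-τ₁) ^ 2 / 2 := by
    have := Real.sigmoid_pos (-τ₁)
    positivity
  -- With `L² = 24² (2N + T)`, the factor `2 L²` of the error bound gives `1152 = 2 · 24²` for `RS`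
  -- and `2304 = 4 · 24²` for `RD² K²`; the `2 + δ` comes from `2N + T ≤ (2 + δ) N`.
  refine ⟨2304 / (Real.sigmoid (-τ₁) ^ 2 / 2) ^ 2, by positivity, fun δ hδ =>
    ⟨1152 * (2 + δ) / (Real.sigmoid (-τ₁) ^ 2 / 2) ^ 2, by positivity, ?_⟩⟩
  intro N T K RS RD τ₂ κ q Ω _ μ _ A hT hTN hκ _ hq hsig hA
  have hT' : (0 : ℝ) < T := by exact_mod_cast hT
  have hN' : (0 : ℝ) < N := pos_of_mul_pos_right (hT'.trans_le hTN) hδ.le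
  have hN : 0 < N := by exact_mod_cast hN'
  have hprob := hA.trilinBound_noise
  have hexp : 0 ≤ T * Real.exp (-(1 * (N : ℝ))) := by positivity
  rw [one_mul (2 * (N : ℝ) + T)]
  -- Everything below is deterministic on the event of the noise bound; the term `T exp(-c₁ N)` is
  -- simply given away.
  refine le_trans (by linarith) (hprob.trans (measureReal_mono ?_))
  intro ω hω p hp
  have herr := hp.error_le hq (by positivity) hω
  rw [mul_pow, Real.sq_sqrt (by positivity)] at herr
  set γ := Real.sigmoid (-τ₁) ^ 2 / 2
  have hS0 : 0 ≤ frobSq (p.S - q.S) := frobSq_nonneg _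
  have hD0 : 0 ≤ ∑ t, frobSq (p.D t - q.D t) := Finset.sum_nonneg fun t _ => frobSq_nonneg _
  have hn : 2 * (N : ℝ) + T ≤ (2 + δ) * N := by linarith
  have hC : 2 * (24 ^ 2 * (2 * (N : ℝ) + T)) / γ ^ 2 * (RS + 2 * RD ^ 2 * K ^ 2)
      ≤ 1152 * (2 + δ) / γ ^ 2 * N * RS + 2304 / γ ^ 2 * K ^ 2 * RD ^ 2 * (2 * N + T) := by
    have h1 := mul_le_mul_of_nonneg_left hn (show 0 ≤ 1152 / γ ^ 2 * (RS : ℝ) by positivity)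
    calc 2 * (24 ^ 2 * (2 * (N : ℝ) + T)) / γ ^ 2 * (RS + 2 * RD ^ 2 * K ^ 2)
        = 1152 / γ ^ 2 * RS * (2 * N + T) + 2304 / γ ^ 2 * K ^ 2 * RD ^ 2 * (2 * N + T) := by ring
      _ ≤ 1152 / γ ^ 2 * RS * ((2 + δ) * N) + 2304 / γ ^ 2 * K ^ 2 * RD ^ 2 * (2 * N + T) := by
          linarith
      _ = _ := by ring
  refine ⟨?_, fun k hk => ?_⟩
  · change frobSq (p.S - q.S) ≤ _
    rw [← add_div, le_div_iff₀ hT']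
    linarith
  · set B := 1152 * (2 + δ) / γ ^ 2 * RS + 2304 / γ ^ 2 * (2 + δ) * K ^ 2 * RD ^ 2 with hB
    have hB0 : 0 ≤ B := by positivity
    have hDB : ∑ t, frobSq (p.D t - q.D t) ≤ N * B := by
      have h1 := mul_le_mul_of_nonneg_left hn
        (show 0 ≤ 2304 / γ ^ 2 * (K : ℝ) ^ 2 * RD ^ 2 by positivity)
      have h2 : N * B = 1152 * (2 + δ) / γ ^ 2 * N * RS
          + 2304 / γ ^ 2 * K ^ 2 * RD ^ 2 * ((2 + δ) * N) := by rw [hB]; ring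
      have h3 : 0 ≤ T * frobSq (p.S - q.S) := by positivity
      linarith
    have hk' : (0 : ℝ) < (q.group k).card := by exact_mod_cast hk
    have hsum : ∑ t ∈ q.group k, alignedDist (p.U (p.g t)) (q.U k) ≤ 2 / κ ^ 2 * B := by
      have h1 (t : Fin T) (ht : t ∈ q.group k) : alignedDist (p.U (p.g t)) (q.U k) ≤
          2 / (N * κ ^ 2) * frobSq (p.D t - q.D t) := by
        -- Only the true label of `t` must be `k`; the estimated frame enters under its own label
        -- `p.g t`.
        have hg : q.g t = k := (Finset.mem_filter.1 ht).2
        rw [← hg]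
        exact alignedDist_le_frobSq hN hκ (hp.1.1.normalized _) (hq.normalized _) (hsig t)
      calc ∑ t ∈ q.group k, alignedDist (p.U (p.g t)) (q.U k)
          ≤ ∑ t ∈ q.group k, 2 / (N * κ ^ 2) * frobSq (p.D t - q.D t) := Finset.sum_le_sum h1
        _ = 2 / (N * κ ^ 2) * ∑ t ∈ q.group k, frobSq (p.D t - q.D t) := by rw [Finset.mul_sum]
        _ ≤ 2 / (N * κ ^ 2) * ∑ t, frobSq (p.D t - q.D t) := 
            mul_le_mul_of_nonneg_left (Finset.sum_le_sum_of_subset_of_nonneg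
              (Finset.subset_univ _) fun t _ _ => frobSq_nonneg _) (by positivity)
        _ ≤ 2 / (N * κ ^ 2) * (N * B) := by gcongr
        _ = 2 / κ ^ 2 * B := by field_simp
    have havg : ((q.group k).card : ℝ)⁻¹ *
        ∑ t ∈ q.group k, alignedDist (p.U (p.g t)) (q.U k) ≤
          8 * (((q.group k).card : ℝ) * κ ^ 2)⁻¹ * B := by
      calc ((q.group k).card : ℝ)⁻¹ * ∑ t ∈ q.group k, alignedDist (p.U (p.g t)) (q.U k)
          ≤ ((q.group k).card : ℝ)⁻¹ * (2 / κ ^ 2 * B) := by gcongr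
        _ = 2 * (((q.group k).card : ℝ) * κ ^ 2)⁻¹ * B := by field_simp
        _ ≤ 8 * (((q.group k).card : ℝ) * κ ^ 2)⁻¹ * B := by gcongr; norm_num
    refine ⟨havg, ?_⟩
    -- The smallest distance over the group is at most the average.
    obtain ⟨t, ht, hmin⟩ := Finset.exists_min_image (q.group k)
      (fun t => alignedDist (p.U (p.g t)) (q.U k)) (Finset.card_pos.1 hk)
    refine ⟨p.g t, Finset.mem_image_of_mem _ ht, le_trans ?_ havg⟩
    rw [inv_mul_eq_div, le_div_iff₀ hk', mul_comm, ← nsmul_eq_mul]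
    exact Finset.card_nsmul_le_sum _ _ _ hmin
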